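/- Let $G$ be a Lie group, $H\subset G$ a closed subgroup, and $z_0\in G$ an element commuting with every element of $H$. Let $Q=H\backslash G$ be the manifold of right cosets (with the smooth structure for which $G\to Q$ is a smooth submersion), with the right action $[x]\cdot g=[xg]$ of $G$ and the quandle operation $[x]\lhd[y]=[z_0^{-1}xy^{-1}z_0y]$. Assume that every map $\bullet\lhd y:Q\to Q$ is the action of some element of $G$ (for instance, $z_0\in H$). Let $q\ge 1$ and assume that $Q$ is $(q-1)$-connected. For a set $X$ let $C_n^{\Delta}(X)$ be the free abelian group on $X^{n+1}$ with $\partial^\Delta(x_0,\dots,x_n)=\sum_{i=0}^n(-1)^i(x_0,\dots,\widehat{x_i},\dots,x_n)$, and let $C_n^{\Delta}(Q)_G$ be the coinvariants of the diagonal $G$-action on $C_n^\Delta(Q)$. Let $C_n^R(Q)$ be the free abelian group on $Q^n$, with $$\partial_n^R(x_1,\dots,x_n)=\sum_{i=1}^n(-1)^i\bigl((x_1,\dots,x_{i-1},x_{i+1},\dots,x_n)-(x_1\lhd x_i,\dots,x_{i-1}\lhd x_i,x_{i+1},\dots,x_n)\bigr).$$ A rack $n$-cocycle with values in an abelian group $A$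 is a homomorphism $f:C_n^R(Q)\to A$ with $f\circ\partial^R_{n+1}=0$. Fix $p\in Q$. For $n\geq 1$ the Inoue–Kabaya map $\varphi_n:C_n^R(Q)\to C_n^\Delta(Q)_G$ is $$\varphi_n(x_1,\dots,x_n)=\sum_{\iota:\{2,\dots,n\}\to\{0,1\}}(-1)^{\iota(2)+\cdots+\iota(n)}\bigl(p,x(\iota,1),\dots,x(\iota,n)\bigr),$$ $$x(\iota,i)=(\cdots((x_i\lhd^{\iota(i+1)}x_{i+1})\lhd^{\iota(i+2)}x_{i+2})\cdots)\lhd^{\iota(n)}x_n,$$ where $x\lhd^0y=x$ and $x\lhd^1y=x\lhd y$; thus $\varphi_1(a)=(p,a)$. Let $C_*^{\rm sing}(Q)$ be the complex of integral smooth singular chains of $Q$ with its right $G$-action, and let $\tau:C_n^\Delta(Q)\to C_n^{\rm sing}(Q)$, $0\le n\le q$, be a chain map of $\mathbb Z[G]$-modules that is compatible with the augmentations to $\mathbb Z$. Let $\omega$ be a smooth closed $G$-invariant complex-valued $q$-form on $Q$ such that $\int_z\omega\in\mathbb Z$ for every integral smooth singular $q$-cycle $z$ of $Q$. Then, for every such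 $\tau$ and $p$, the cochain $$\mathcal T(\omega):Q^{q+1}\to\mathbb C/\mathbb Z,\qquad \mathcal T(\omega)(x_0,\dots,x_q)=\int_{\tau(x_0,\dots,x_q)}\omega \mod \mathbb Z,$$ descends to a homomorphism $C_q^\Delta(Q)_G\to\mathbb C/\mathbb Z$, and its pullback $\varphi_q^*(\mathcal T(\omega))=\mathcal T(\omega)\circ\varphi_q:C_q^R(Q)\to\mathbb C/\mathbb Z$ is a rack $q$-cocycle of $Q$. -/

import Mathlib

open scoped Manifold ContDiff Quandles Topology

noncomputable section

namespace SmoothQuandle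

/-! ### The quandle `(G, H, z₀)` -/

/-- The homogeneous space `H \ G` of right cosets `H g`, as the underlying type of the quandle
`(G, H, z₀)`, where `z₀` commutes with every element of `H`. -/
def CosetQuandle {G : Type*} [Group G] (H : Subgroup G)
    (_z₀ : Subgroup.centralizer (H : Set G)) : Type _ :=
  Quotient (QuotientGroup.rightRel H)

namespace CosetQuandle

variable {G : Type*} [Group G] {H : Subgroup G} {z₀ : Subgroup.centralizer (H : Set G)}

/-- The projection `g ↦ [g] = H g`. -/
def mk (H : Subgroup G) (z₀ : Subgroup.centralizer (H : Set G)) (g : G) : CosetQuandle H z₀ :=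
  Quotient.mk (QuotientGroup.rightRel H) g

theorem mk_eq_mk_iff {a b : G} : mk H z₀ a = mk H z₀ b ↔ b * a⁻¹ ∈ H := by
  have h : mk H z₀ a = mk H z₀ b ↔ QuotientGroup.rightRel H a b := Quotient.eq
  exact h.trans QuotientGroup.rightRel_apply

theorem mk_surjective : Function.Surjective (mk H z₀) := Quotient.mk_surjective

theorem z₀_comm {h : G} (hh : h ∈ H) : h * (z₀ : G) = (z₀ : G) * h :=
  Subgroup.mem_centralizer_iff.1 z₀.2 h hh

/-- The right action of `g ∈ G` on `H \ G`, `[x] ↦ [x g]`. -/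
def translate (g : G) : CosetQuandle H z₀ → CosetQuandle H z₀ :=
  Quotient.lift (fun x => mk H z₀ (x * g)) (by
    intro a b hab
    have h1 : b * a⁻¹ ∈ H := QuotientGroup.rightRel_apply.1 hab
    rw [mk_eq_mk_iff]
    simpa [mul_assoc] using h1)

@[simp] theorem translate_mk (g x : G) : translate g (mk H z₀ x) = mk H z₀ (x * g) := rfl

/-- `tri [x] [y] = [x] ◁ [y] = [z₀⁻¹ x y⁻¹ z₀ y]`. -/
def tri : CosetQuandle H z₀ → CosetQuandle H z₀ → CosetQuandle H z₀ :=
  Quotient.lift₂ (fun x y => mk H z₀ ((z₀ : G)⁻¹ * x * y⁻¹ * z₀ * y)) (by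
    intro a b a' b' ha hb
    have h1 : a' * a⁻¹ ∈ H := QuotientGroup.rightRel_apply.1 ha
    have h2 : b' * b⁻¹ ∈ H := QuotientGroup.rightRel_apply.1 hb
    obtain ⟨h, hh, rfl⟩ : ∃ h ∈ H, a' = h * a := ⟨_, h1, by group⟩
    obtain ⟨k, hk, rfl⟩ : ∃ k ∈ H, b' = k * b := ⟨_, h2, by group⟩
    rw [mk_eq_mk_iff]
    have e1 : h * (z₀ : G) = z₀ * h := z₀_comm hh
    have e2 : k * (z₀ : G) = z₀ * k := z₀_comm hk
    have e3 : (z₀ : G)⁻¹ * h = h * (z₀ : G)⁻¹ := by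
      rw [inv_mul_eq_iff_eq_mul, ← mul_assoc, ← e1, mul_inv_cancel_right]
    have e4 : k⁻¹ * (z₀ : G) * k = z₀ := by
      rw [mul_assoc, ← e2, inv_mul_cancel_left]
    have : (z₀ : G)⁻¹ * (h * a) * (k * b)⁻¹ * z₀ * (k * b)
        * ((z₀ : G)⁻¹ * a * b⁻¹ * z₀ * b)⁻¹ = h := by
      calc _ = ((z₀ : G)⁻¹ * h) * a * b⁻¹ * (k⁻¹ * (z₀ : G) * k) * (z₀ : G)⁻¹ * b * a⁻¹ * z₀ := by
            group
        _ = h := by rw [e3, e4]; group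
    rw [this]
    exact hh)

/-- The inverse operation, `[x] ◁⁻¹ [y] = [z₀ x y⁻¹ z₀⁻¹ y]`. -/
def triInv : CosetQuandle H z₀ → CosetQuandle H z₀ → CosetQuandle H z₀ :=
  Quotient.lift₂ (fun x y => mk H z₀ ((z₀ : G) * x * y⁻¹ * (z₀ : G)⁻¹ * y)) (by
    intro a b a' b' ha hb
    have h1 : a' * a⁻¹ ∈ H := QuotientGroup.rightRel_apply.1 ha
    have h2 : b' * b⁻¹ ∈ H := QuotientGroup.rightRel_apply.1 hb
    obtain ⟨h, hh, rfl⟩ : ∃ h ∈ H, a' = h * a := ⟨_, h1, by group⟩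
    obtain ⟨k, hk, rfl⟩ : ∃ k ∈ H, b' = k * b := ⟨_, h2, by group⟩
    rw [mk_eq_mk_iff]
    have e1 : h * (z₀ : G) = z₀ * h := z₀_comm hh
    have e2 : k * (z₀ : G) = z₀ * k := z₀_comm hk
    have e4 : k⁻¹ * (z₀ : G)⁻¹ * k = (z₀ : G)⁻¹ := by
      rw [← mul_inv_rev, ← e2, mul_inv_rev, inv_mul_cancel_right]
    have : (z₀ : G) * (h * a) * (k * b)⁻¹ * (z₀ : G)⁻¹ * (k * b)
        * ((z₀ : G) * a * b⁻¹ * (z₀ : G)⁻¹ * b)⁻¹ = h := by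
      calc _ = ((z₀ : G) * h) * a * b⁻¹ * (k⁻¹ * (z₀ : G)⁻¹ * k) * z₀ * b * a⁻¹ * (z₀ : G)⁻¹ := by
            group
        _ = h := by rw [← e1, e4]; group
    rw [this]
    exact hh)

/-- The quandle structure on `H \ G`. Mathlib's quandles act from the left, so that
`y ◃ x` (`Shelf.act y x`) is the element `x ◁ y = [z₀⁻¹ x y⁻¹ z₀ y]`. -/
instance : Quandle (CosetQuandle H z₀) where
  act y x := tri x y
  self_distrib := by
    intro x y z
    obtain ⟨x, rfl⟩ := mk_surjective x
    obtain ⟨y, rfl⟩ := mk_surjective y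
    obtain ⟨z, rfl⟩ := mk_surjective z
    change mk H z₀ _ = mk H z₀ _
    congr 1
    group
  invAct y x := triInv x y
  left_inv := by
    intro y x
    obtain ⟨x, rfl⟩ := mk_surjective x
    obtain ⟨y, rfl⟩ := mk_surjective y
    change mk H z₀ _ = mk H z₀ _
    congr 1
    group
  right_inv := by
    intro y x
    obtain ⟨x, rfl⟩ := mk_surjective x
    obtain ⟨y, rfl⟩ := mk_surjective y
    change mk H z₀ _ = mk H z₀ _
    congr 1
    group
  fix := by
    intro x
    obtain ⟨x, rfl⟩ := mk_surjective x
    change mk H z₀ _ = mk H z₀ _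
    congr 1
    group

theorem mk_act_mk (x y : G) :
    (mk H z₀ y) ◃ (mk H z₀ x) = mk H z₀ ((z₀ : G)⁻¹ * x * y⁻¹ * z₀ * y) := rfl

/-- `H \ G` carries the quotient topology. -/
instance [TopologicalSpace G] : TopologicalSpace (CosetQuandle H z₀) :=
  inferInstanceAs (TopologicalSpace (Quotient (QuotientGroup.rightRel H)))

/-- If `H \ G` carries a manifold structure for which the projection `G → H \ G` is a smooth
submersion, then `G` acts on `H \ G` by smooth maps. -/
theorem contMDiff_translate {EG EQ : Type*} [NormedAddCommGroup EG] [NormedSpace ℝ EG]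
    [NormedAddCommGroup EQ] [NormedSpace ℝ EQ]
    [TopologicalSpace G] [ChartedSpace EG G] [LieGroup 𝓘(ℝ, EG) ∞ G]
    [ChartedSpace EQ (CosetQuandle H z₀)] [IsManifold 𝓘(ℝ, EQ) ∞ (CosetQuandle H z₀)]
    (hmk : Manifold.IsSubmersion 𝓘(ℝ, EG) 𝓘(ℝ, EQ) ∞ (mk H z₀)) (g : G) :
    ContMDiff 𝓘(ℝ, EQ) 𝓘(ℝ, EQ) ∞ (translate (H := H) (z₀ := z₀) g) := by
  intro y
  obtain ⟨a, rfl⟩ := mk_surjective y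
  have h := hmk.isSubmersionAt a
  set φ := h.domChart with hφ
  set ψ := h.codChart with hψ
  have haφ : a ∈ φ.source := h.mem_domChart_source
  have haψ : mk H z₀ a ∈ ψ.source := h.mem_codChart_source
  have key : ∀ u ∈ φ.target, ψ (mk H z₀ (φ.symm u)) = (h.equiv u).1 := by
    intro u hu
    have hu' : u ∈ (φ.extend 𝓘(ℝ, EG)).target := by simpa using hu
    have := h.writtenInCharts hu'
    simpa using this
  -- a smooth local section of the projection
  let F : EQ → EG := fun v => h.equiv.symm (v, (h.equiv (φ a)).2)
  have hF : ContDiff ℝ ∞ F := h.equiv.symm.contDiff.comp (contDiff_id.prodMk contDiff_const)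
  have hbase : F (ψ (mk H z₀ a)) = φ a := by
    have h1 : ψ (mk H z₀ a) = (h.equiv (φ a)).1 := by
      have := key (φ a) (φ.map_source haφ)
      rwa [φ.left_inv haφ] at this
    change h.equiv.symm (ψ (mk H z₀ a), (h.equiv (φ a)).2) = φ a
    rw [h1, Prod.mk.eta, ContinuousLinearEquiv.symm_apply_apply]
  have hψs : ContMDiffAt 𝓘(ℝ, EQ) 𝓘(ℝ, EQ) ∞ ψ (mk H z₀ a) :=
    contMDiffAt_of_mem_maximalAtlas h.codChart_mem_maximalAtlas haψ
  have hFψ : ContMDiffAt 𝓘(ℝ, EQ) 𝓘(ℝ, EG) ∞ (fun y => F (ψ y)) (mk H z₀ a) :=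
    hF.contMDiff.contMDiffAt.comp _ hψs
  have hφs : ContMDiffAt 𝓘(ℝ, EG) 𝓘(ℝ, EG) ∞ φ.symm (F (ψ (mk H z₀ a))) := by
    rw [hbase]
    exact contMDiffAt_symm_of_mem_maximalAtlas h.domChart_mem_maximalAtlas (φ.map_source haφ)
  have hs : ContMDiffAt 𝓘(ℝ, EQ) 𝓘(ℝ, EG) ∞ (fun y => φ.symm (F (ψ y))) (mk H z₀ a) :=
    hφs.comp (mk H z₀ a) hFψ
  have htot : ContMDiffAt 𝓘(ℝ, EQ) 𝓘(ℝ, EQ) ∞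
      (fun y => mk H z₀ (φ.symm (F (ψ y)) * g)) (mk H z₀ a) :=
    hmk.contMDiff.contMDiffAt.comp (mk H z₀ a)
      ((contMDiff_mul_right (I := 𝓘(ℝ, EG)) (n := ∞) (a := g)).contMDiffAt.comp
        (mk H z₀ a) hs)
  refine htot.congr_of_eventuallyEq ?_
  have hev : ∀ᶠ y in 𝓝 (mk H z₀ a), F (ψ y) ∈ φ.target :=
    hFψ.continuousAt.eventually_mem (φ.open_target.mem_nhds (by
      rw [hbase]; exact φ.map_source haφ))
  filter_upwards [hev, ψ.open_source.mem_nhds haψ] with y hy hyψ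
  have h1 : ψ (mk H z₀ (φ.symm (F (ψ y)))) = ψ y := by
    rw [key _ hy]
    change (h.equiv (h.equiv.symm (ψ y, (h.equiv (φ a)).2))).1 = ψ y
    rw [ContinuousLinearEquiv.apply_symm_apply]
  have h2 : mk H z₀ (φ.symm (F (ψ y))) = y :=
    ψ.injOn (h.source_subset_preimage_source (φ.map_target hy)) hyψ h1
  rw [← translate_mk, h2]

end CosetQuandle

/-! ### Rack chains and homogeneous chains -/

/-- `C_n^R(X)`, the free abelian group on `X^n`. -/
abbrev RackChain (X : Type*) (n : ℕ) : Type _ := FreeAbelianGroup (Fin n → X)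

/-- `(x_1, …, x_{n+1}) ↦ (x_1, …, x_{i-1}, x_{i+1}, …, x_{n+1})`. -/
def rackFace₀ {X : Type*} {n : ℕ} (i : Fin (n + 1)) (x : Fin (n + 1) → X) : Fin n → X :=
  fun j => x (i.succAbove j)

/-- `(x_1, …, x_{n+1}) ↦ (x_1 ◁ x_i, …, x_{i-1} ◁ x_i, x_{i+1}, …, x_{n+1})`. -/
def rackFace₁ {X : Type*} [Shelf X] {n : ℕ} (i : Fin (n + 1)) (x : Fin (n + 1) → X) :
    Fin n → X :=
  fun j => if j.castSucc < i then x i ◃ x (i.succAbove j) else x (i.succAbove j)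

/-- The boundary `∂^R_{n+1} : C_{n+1}^R(X) → C_n^R(X)`. The index `i : Fin (n + 1)` stands for
the position `i + 1`, hence the exponent of the sign. -/
def rackBoundary (X : Type*) [Shelf X] (n : ℕ) : RackChain X (n + 1) →+ RackChain X n :=
  FreeAbelianGroup.lift fun x => ∑ i : Fin (n + 1), (-1 : ℤ) ^ ((i : ℕ) + 1) •
    (FreeAbelianGroup.of (rackFace₀ i x) - FreeAbelianGroup.of (rackFace₁ i x))

/-- A rack `n`-cochain `f ∈ C^n_R(X; A) = Hom(C_n^R(X), A)` is a cocycle if `f ∘ ∂^R_{n+1} = 0`. -/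
def IsRackCocycle {X : Type*} [Shelf X] {A : Type*} [AddCommGroup A] {n : ℕ}
    (f : RackChain X n →+ A) : Prop :=
  f.comp (rackBoundary X n) = 0

/-- `C_n^Δ(X)`, the free abelian group on `X^{n+1}`. -/
abbrev TupleChain (X : Type*) (n : ℕ) : Type _ := FreeAbelianGroup (Fin (n + 1) → X)

/-- The boundary `∂_{n+1}^Δ`, the alternating sum of the omissions of one entry. -/
def tupleBoundary (X : Type*) (n : ℕ) : TupleChain X (n + 1) →+ TupleChain X n :=
  FreeAbelianGroup.lift fun x => ∑ i : Fin (n + 2), (-1 : ℤ) ^ (i : ℕ) •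
    FreeAbelianGroup.of fun j => x (i.succAbove j)

/-- The augmentation `C_0^Δ(X) → ℤ`. -/
def tupleAugmentation (X : Type*) : TupleChain X 0 →+ ℤ := FreeAbelianGroup.lift fun _ => 1

/-- The map induced on `C_n^Δ(X)` by a self-map of `X`, applied to every entry. -/
def tupleMap {X : Type*} (f : X → X) (n : ℕ) : TupleChain X n →+ TupleChain X n :=
  FreeAbelianGroup.map fun x j => f (x j)

section

variable {G : Type*} [Group G] (H : Subgroup G) (z₀ : Subgroup.centralizer (H : Set G))

/-- The subgroup of `C_n^Δ(Q)` generated by the differences `c · g - c`, for `Q = (G, H, z₀)`. -/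
def coinvariantsKer (n : ℕ) : AddSubgroup (TupleChain (CosetQuandle H z₀) n) :=
  AddSubgroup.closure
    {d | ∃ (g : G) (c : TupleChain (CosetQuandle H z₀) n),
      d = tupleMap (CosetQuandle.translate g) n c - c}

/-- The coinvariants `C_n^Δ(Q)_G`. -/
abbrev Coinvariants (n : ℕ) : Type _ := TupleChain (CosetQuandle H z₀) n ⧸ coinvariantsKer H z₀ n

end

/-- The element `x(ι, i) = (⋯(x_i ◁^{ι(i+1)} x_{i+1}) ◁^{ι(i+2)} ⋯) ◁^{ι(n)} x_n` with `n = k + 1`,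
where `x ◁^0 y = x` and `x ◁^1 y = x ◁ y`. Positions are counted from `0` here, and `ι j` is the
exponent that belongs to the entry `x j.succ`. -/
def iteratedTri {X : Type*} [Shelf X] {k : ℕ} (x : Fin (k + 1) → X) (ι : Fin k → Bool)
    (i : Fin (k + 1)) : X :=
  Fin.foldl k (fun a j => if i < j.succ ∧ ι j = true then x j.succ ◃ a else a) (x i)

/-- The chain-level formula of the Inoue–Kabaya map in degree `k + 1`,
`(x_1, …, x_{k+1}) ↦ ∑_ι (-1)^{∑ ι(j)} (p, x(ι, 1), …, x(ι, k+1))`. -/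
def inoueKabayaLift {X : Type*} [Shelf X] (p : X) (k : ℕ) :
    RackChain X (k + 1) →+ TupleChain X (k + 1) :=
  FreeAbelianGroup.lift fun x => ∑ ι : Fin k → Bool,
    (-1 : ℤ) ^ (Finset.univ.filter fun j => ι j = true).card •
      FreeAbelianGroup.of (Fin.cons p (iteratedTri x ι) : Fin (k + 2) → X)

/-- The Inoue–Kabaya map `φ_{k+1} : C_{k+1}^R(Q) → C_{k+1}^Δ(Q)_G` with base point `p`. -/
def inoueKabaya {G : Type*} [Group G] {H : Subgroup G} {z₀ : Subgroup.centralizer (H : Set G)}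
    (p : CosetQuandle H z₀) (k : ℕ) :
    RackChain (CosetQuandle H z₀) (k + 1) →+ Coinvariants H z₀ (k + 1) :=
  (QuotientAddGroup.mk' (coinvariantsKer H z₀ (k + 1))).comp (inoueKabayaLift p k)

/-! ### Smooth singular chains and differential forms -/

/-- A nonempty space all of whose homotopy groups (sets) in degrees `≤ k` are trivial. -/
def IsNConnected (k : ℕ) (M : Type*) [TopologicalSpace M] : Prop :=
  Nonempty M ∧ ∀ i ≤ k, ∀ x : M, Subsingleton (π_ i M x)

section

variable (E : Type*) [NormedAddCommGroup E] [NormedSpace ℝ E]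
  (M : Type*) [TopologicalSpace M] [ChartedSpace E M]

/-- A smooth singular `n`-simplex in `M`: a map on the standard simplex
`{t ∈ ℝ^{n+1} | t_i ≥ 0, ∑ t_i = 1}` that extends to a smooth map on an open neighbourhood. -/
structure SmoothSimplex (n : ℕ) where
  toFun : stdSimplex ℝ (Fin (n + 1)) → M
  exists_extension : ∃ (U : Set (Fin (n + 1) → ℝ)) (f : (Fin (n + 1) → ℝ) → M),
    IsOpen U ∧ stdSimplex ℝ (Fin (n + 1)) ⊆ U ∧
      ContMDiffOn 𝓘(ℝ, Fin (n + 1) → ℝ) 𝓘(ℝ, E) ∞ f U ∧ ∀ t, toFun t = f t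

/-- Smooth singular `n`-chains with integer coefficients. -/
abbrev SmoothChain (n : ℕ) : Type _ := FreeAbelianGroup (SmoothSimplex E M n)

variable {E M}

/-- The face `σ ∘ ε^i`, where `ε^i` inserts a zero at the `i`-th barycentric coordinate. -/
def SmoothSimplex.face {n : ℕ} (σ : SmoothSimplex E M (n + 1)) (i : Fin (n + 2)) :
    SmoothSimplex E M n where
  toFun t := σ.toFun (stdSimplex.map i.succAbove t)
  exists_extension := by
    obtain ⟨U, f, hU, hsub, hf, hσ⟩ := σ.exists_extension
    let L : (Fin (n + 1) → ℝ) →L[ℝ] (Fin (n + 2) → ℝ) :=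
      LinearMap.toContinuousLinearMap (FunOnFinite.linearMap ℝ ℝ i.succAbove)
    refine ⟨L ⁻¹' U, f ∘ L, hU.preimage L.continuous, ?_, ?_, ?_⟩
    · intro t ht
      exact hsub (stdSimplex.map i.succAbove ⟨t, ht⟩).2
    · exact hf.comp L.contDiff.contMDiff.contMDiffOn (fun _ h => h)
    · intro t
      exact hσ _

/-- The composite of a smooth simplex with a smooth map. -/
def SmoothSimplex.map {f : M → M} (hf : ContMDiff 𝓘(ℝ, E) 𝓘(ℝ, E) ∞ f) {n : ℕ}
    (σ : SmoothSimplex E M n) : SmoothSimplex E M n where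
  toFun t := f (σ.toFun t)
  exists_extension := by
    obtain ⟨U, h, hU, hsub, hh, hσ⟩ := σ.exists_extension
    exact ⟨U, f ∘ h, hU, hsub, hf.comp_contMDiffOn hh, fun t => congrArg f (hσ t)⟩

variable (E M)

/-- The boundary of smooth singular chains. -/
def smoothBoundary (n : ℕ) : SmoothChain E M (n + 1) →+ SmoothChain E M n :=
  FreeAbelianGroup.lift fun σ => ∑ i : Fin (n + 2), (-1 : ℤ) ^ (i : ℕ) •
    FreeAbelianGroup.of (σ.face i)

/-- The augmentation of smooth singular `0`-chains. -/
def smoothAugmentation : SmoothChain E M 0 →+ ℤ := FreeAbelianGroup.lift fun _ => 1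

variable {E M}

/-- The map induced on smooth singular chains by a smooth map. -/
def smoothChainMap {f : M → M} (hf : ContMDiff 𝓘(ℝ, E) 𝓘(ℝ, E) ∞ f) (n : ℕ) :
    SmoothChain E M n →+ SmoothChain E M n :=
  FreeAbelianGroup.map (SmoothSimplex.map hf)

/-- The simplex `{t ∈ ℝ^n | t_j ≥ 0, ∑ t_j ≤ 1}`. -/
def cornerSimplex (n : ℕ) : Set (Fin n → ℝ) := {t | (∀ j, 0 ≤ t j) ∧ ∑ j, t j ≤ 1}

theorem cons_mem_stdSimplex {n : ℕ} {t : Fin n → ℝ} (ht : t ∈ cornerSimplex n) :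
    (Fin.cons (1 - ∑ j, t j) t : Fin (n + 1) → ℝ) ∈ stdSimplex ℝ (Fin (n + 1)) := by
  refine ⟨fun i => ?_, ?_⟩
  · refine Fin.cases ?_ (fun j => ?_) i
    · simpa using ht.2
    · simpa using ht.1 j
  · rw [Fin.sum_univ_succ]
    simp

open Classical in
/-- A simplex in the coordinates `(t_1, …, t_n) ∈ cornerSimplex n` of the standard simplex,
`t ↦ σ(1 - ∑ t_j, t_1, …, t_n)`; the value off `cornerSimplex n` is immaterial. -/
def SmoothSimplex.inCoords {n : ℕ} (σ : SmoothSimplex E M n) (t : Fin n → ℝ) : M :=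
  if ht : t ∈ cornerSimplex n then σ.toFun ⟨_, cons_mem_stdSimplex ht⟩
  else σ.toFun ⟨_, single_mem_stdSimplex ℝ 0⟩

/-- A field of `ℂ`-valued alternating `q`-forms on the tangent spaces of `M`, read in the
preferred chart at `x₀`: the pullback under the inverse of the chart. -/
def formInChart {q : ℕ} (α : ∀ x : M, TangentSpace 𝓘(ℝ, E) x [⋀^Fin q]→L[ℝ] ℂ) (x₀ : M) (y : E) :
    E [⋀^Fin q]→L[ℝ] ℂ :=
  (α ((extChartAt 𝓘(ℝ, E) x₀).symm y)).compContinuousLinearMap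
    (mfderiv 𝓘(ℝ, E) 𝓘(ℝ, E) (extChartAt 𝓘(ℝ, E) x₀).symm y)

variable (E M)

/-- Smooth complex-valued differential `q`-forms on `M`. -/
structure SmoothForm (q : ℕ) where
  toFun : ∀ x : M, TangentSpace 𝓘(ℝ, E) x [⋀^Fin q]→L[ℝ] ℂ
  contDiffOn_inChart : ∀ x₀ : M,
    ContDiffOn ℝ ∞ (formInChart toFun x₀) (extChartAt 𝓘(ℝ, E) x₀).target

variable {E M}

/-- `dα = 0`. -/
def SmoothForm.Closed {q : ℕ} (α : SmoothForm E M q) : Prop :=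
  ∀ x₀ : M, ∀ y ∈ (extChartAt 𝓘(ℝ, E) x₀).target, extDeriv (formInChart α.toFun x₀) y = 0

/-- `f^* α = α`. -/
def SmoothForm.InvariantUnder {q : ℕ} (α : SmoothForm E M q) (f : M → M) : Prop :=
  ∀ x : M, (α.toFun (f x)).compContinuousLinearMap (mfderiv 𝓘(ℝ, E) 𝓘(ℝ, E) f x) = α.toFun x

/-- `∫_σ α` for a smooth simplex `σ`. -/
def SmoothForm.integralSimplex {q : ℕ} (α : SmoothForm E M q) (σ : SmoothSimplex E M q) : ℂ :=
  ∫ t in cornerSimplex q, α.toFun (σ.inCoords t) fun j =>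
    mfderivWithin 𝓘(ℝ, Fin q → ℝ) 𝓘(ℝ, E) σ.inCoords (cornerSimplex q) t
      (Pi.single j 1 : Fin q → ℝ)

/-- `∫_c α` for a smooth singular chain `c`. -/
def SmoothForm.integral {q : ℕ} (α : SmoothForm E M q) : SmoothChain E M q →+ ℂ :=
  FreeAbelianGroup.lift α.integralSimplex

end

/-! ### The chain map `τ` and the cochain `𝒯(α)` -/

section

variable {EG EQ : Type*} [NormedAddCommGroup EG] [NormedSpace ℝ EG]
  [NormedAddCommGroup EQ] [NormedSpace ℝ EQ]
  {G : Type*} [Group G] [TopologicalSpace G] [ChartedSpace EG G] [LieGroup 𝓘(ℝ, EG) ∞ G]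
  {H : Subgroup G} {z₀ : Subgroup.centralizer (H : Set G)}
  [ChartedSpace EQ (CosetQuandle H z₀)] [IsManifold 𝓘(ℝ, EQ) ∞ (CosetQuandle H z₀)]

/-- A `ℤ[G]`-chain map `τ : C_n^Δ(Q) → C_n^{sing}(Q)`, `n ≤ q`, over the identity of `ℤ`
(the components in degrees `> q` carry no condition). -/
structure EquivariantChainMap
    (hmk : Manifold.IsSubmersion 𝓘(ℝ, EG) 𝓘(ℝ, EQ) ∞ (CosetQuandle.mk H z₀)) (q : ℕ) where
  toFun : ∀ n : ℕ, TupleChain (CosetQuandle H z₀) n →+ SmoothChain EQ (CosetQuandle H z₀) n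
  augmentation : ∀ c, smoothAugmentation EQ (CosetQuandle H z₀) (toFun 0 c) =
    tupleAugmentation (CosetQuandle H z₀) c
  boundary : ∀ n, n + 1 ≤ q → ∀ c, smoothBoundary EQ (CosetQuandle H z₀) n (toFun (n + 1) c) =
    toFun n (tupleBoundary (CosetQuandle H z₀) n c)
  equivariant : ∀ n ≤ q, ∀ (g : G) (c), toFun n (tupleMap (CosetQuandle.translate g) n c) =
    smoothChainMap (CosetQuandle.contMDiff_translate hmk g) n (toFun n c)

/-- The cochain `𝒯(α) : C_q^Δ(Q) → ℂ/ℤ`, `(x_0, …, x_q) ↦ ∫_{τ(x_0, …, x_q)} α mod ℤ`. -/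
def secondaryCochain
    {hmk : Manifold.IsSubmersion 𝓘(ℝ, EG) 𝓘(ℝ, EQ) ∞ (CosetQuandle.mk H z₀)} {q : ℕ}
    (α : SmoothForm EQ (CosetQuandle H z₀) q) (τ : EquivariantChainMap hmk q) :
    TupleChain (CosetQuandle H z₀) q →+ ℂ ⧸ AddSubgroup.zmultiples (1 : ℂ) :=
  (QuotientAddGroup.mk' (AddSubgroup.zmultiples (1 : ℂ))).comp (α.integral.comp (τ.toFun q))

end

end SmoothQuandle

end

/-! Write `n = q + 1`. The cocycle condition for `𝒯(ω) ∘ φ` splits into two facts.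

The Inoue–Kabaya map commutes with boundaries modulo the action of `G`. In the boundary of `∑ ± (p,
x(ι, 1), …, x(ι, n))`, deleting `x(ι, i)` and summing over `ι(i)` gives the difference of the two
rack faces at `i`, by self-distributivity; for `i = 1` the terms cancel in pairs, as the two rack
faces agree. The faces without `p` pair up along `ι(n)`: the tuple with `ι(n) = 1` is the one with
`ι(n) = 0` moved by `• ◁ x_n`, its last entry included since `x_n ◁ x_n = x_n`. By `hInn` the pair
differs by an element of `G` and dies in the coinvariants (`sum_sign_delete`,
`sum_iteratedTri_mem_coinvariantsKer`).

The cochain `𝒯(ω)` descends to coinvariants, as `τ` is equivariant and `ω` invariant, and it kills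
boundaries: `∂τ∂c = τ∂∂c = 0`, so `τ(∂c)` is a cycle and its period is an integer. No component of
`τ` in degree `q + 1` is needed. -/

namespace SmoothQuandle

/-! ### The iterated quandle operation -/

section IteratedTri

variable {X : Type*} [Shelf X]

theorem iteratedTri_last {k : ℕ} (x : Fin (k + 1) → X) (ι : Fin k → Bool) :
    iteratedTri x ι (Fin.last k) = x (Fin.last k) := by
  have h : (fun (a : X) (j : Fin k) =>
      if Fin.last k < j.succ ∧ ι j = true then x j.succ ◃ a else a) = fun a _ => a := by
    funext a j
    rw [if_neg]
    exact fun h => absurd h.1 (not_lt.2 (Fin.le_last _))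
  rw [iteratedTri, h]
  generalize x (Fin.last k) = a
  clear h ι x
  induction k with
  | zero => rfl
  | succ k ih => rw [Fin.foldl_succ_last]; exact ih

/-- The fold runs through the exponents in increasing order, so the last one is the outermost
operation. This recursion drives the inductions below. -/
theorem iteratedTri_castSucc {k : ℕ} (x : Fin (k + 2) → X) (ι : Fin (k + 1) → Bool)
    (i : Fin (k + 1)) :
    iteratedTri x ι i.castSucc =
      if ι (Fin.last k) = true then
        x (Fin.last (k + 1)) ◃
          iteratedTri (fun j => x j.castSucc) (fun j => ι j.castSucc) i
      else iteratedTri (fun j => x j.castSucc) (fun j => ι j.castSucc) i := by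
  have h : i.castSucc < Fin.last (k + 1) := Fin.castSucc_lt_last i
  simp only [iteratedTri, Fin.foldl_succ_last, Fin.succ_last, h, true_and, Fin.succ_castSucc,
    Fin.castSucc_lt_castSucc_iff]

/-- Self-distributivity makes `a ◃ ·` an endomorphism, hence compatible with every iterated product.
-/
theorem act_iteratedTri {k : ℕ} (a : X) (x : Fin (k + 1) → X) (ι : Fin k → Bool)
    (i : Fin (k + 1)) :
    iteratedTri (fun j => a ◃ x j) ι i = a ◃ iteratedTri x ι i := by
  induction k with
  | zero => rfl
  | succ k ih =>
    refine Fin.lastCases ?_ (fun i => ?_) i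
    · simp only [iteratedTri_last]
    · rw [iteratedTri_castSucc, iteratedTri_castSucc, ih (fun j => x j.castSucc)]
      split_ifs
      · exact (Shelf.self_distrib).symm
      · rfl

/-- Deleting the entry `x i.succ` from the tuple of the `iteratedTri x ι`. -/
theorem iteratedTri_succ_succAbove {k : ℕ} (x : Fin (k + 2) → X) (ι : Fin (k + 1) → Bool)
    (i j : Fin (k + 1)) :
    iteratedTri x ι (i.succ.succAbove j) =
      iteratedTri (if ι i = true then rackFace₁ i.succ x else rackFace₀ i.succ x)
        (fun l => ι (i.succAbove l)) j := by
  induction k with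
  | zero =>
    obtain rfl : i = 0 := Fin.fin_one_eq_zero i
    obtain rfl : j = 0 := Fin.fin_one_eq_zero j
    rw [show (Fin.succ 0 : Fin 2).succAbove 0 = (0 : Fin 1).castSucc from rfl,
      iteratedTri_castSucc]
    change (if ι 0 = true then _ else _) = _
    split_ifs <;> rfl
  | succ k ih =>
    refine Fin.lastCases ?_ (fun i => ?_) i
    -- Deleting the last entry: its operation, if present, is outermost and moves inside onto all
    -- remaining entries, which is `rackFace₁`.
    · simp only [Fin.succ_last, Fin.succAbove_last, iteratedTri_castSucc]
      split_ifs with h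
      · rw [← act_iteratedTri]
        congr 1
        funext l
        simp [rackFace₁, Fin.castSucc_lt_last]
      · congr 1
        funext l
        simp [rackFace₀]
    · refine Fin.lastCases ?_ (fun j => ?_) j
      · rw [iteratedTri_last, Fin.succ_castSucc, Fin.succAbove_of_le_castSucc _ _
          (by simp [Fin.le_def]; omega), Fin.succ_last, iteratedTri_last]
        split_ifs with h
        · simp [rackFace₁, Fin.lt_def]
          omega
        · simp [rackFace₀]
      · rw [Fin.succ_castSucc, Fin.castSucc_succAbove_castSucc, iteratedTri_castSucc,
          iteratedTri_castSucc, ih]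
        -- A face at an earlier position keeps the last entry and commutes with dropping it, so the
        -- outermost operation agrees on both sides.
        have h1 : ∀ b : Bool, (if b = true then rackFace₁ i.succ.castSucc x else
            rackFace₀ i.succ.castSucc x) (Fin.last (k + 1)) = x (Fin.last (k + 2)) := by
          intro b
          have hn : ¬ (Fin.last (k + 1)).castSucc < i.succ.castSucc := by
            simp [Fin.lt_def]; omega
          have hs : i.succ.castSucc.succAbove (Fin.last (k + 1)) = Fin.last (k + 2) := by
            rw [Fin.succAbove_of_le_castSucc _ _ (not_lt.1 hn), Fin.succ_last]
          split_ifs <;> simp only [rackFace₀, rackFace₁, hn, hs, if_false]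
        have h2 : ∀ b : Bool, (fun l : Fin (k + 1) =>
            (if b = true then rackFace₁ i.succ.castSucc x else
              rackFace₀ i.succ.castSucc x) l.castSucc) =
            if b = true then rackFace₁ i.succ (fun l => x l.castSucc) else
              rackFace₀ i.succ (fun l => x l.castSucc) := by
          intro b
          funext l
          split_ifs <;> simp only [rackFace₀, rackFace₁, Fin.castSucc_succAbove_castSucc,
            Fin.castSucc_lt_castSucc_iff]
        have hl : i.castSucc.succAbove (Fin.last k) = Fin.last (k + 1) := by
          rw [Fin.succAbove_of_le_castSucc _ _ (by simp [Fin.le_def]; omega), Fin.succ_last]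
        simp only [h1, h2, hl, Fin.castSucc_succAbove_castSucc]

/-- Deleting the first entry. -/
theorem iteratedTri_succ {k : ℕ} (x : Fin (k + 2) → X) (ι : Fin (k + 1) → Bool)
    (j : Fin (k + 1)) :
    iteratedTri x ι j.succ = iteratedTri (fun l => x l.succ) (fun l => ι l.succ) j := by
  -- The exponent `ι 0` belongs to `x 1` and acts on `x 0` only, so it disappears.
  simp only [iteratedTri, Fin.foldl_succ, Fin.succ_lt_succ_iff, Fin.not_lt_zero, false_and,
    if_false]

end IteratedTri

/-! ### The Inoue–Kabaya map is a chain map -/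

theorem sign_eq_prod {k : ℕ} (ι : Fin k → Bool) :
    (-1 : ℤ) ^ (Finset.univ.filter fun j => ι j = true).card =
      ∏ j, if ι j = true then -1 else 1 := by
  rw [Finset.prod_ite]
  simp

/-- Flipping one exponent reverses the sign. All cancellations in the sums over `ι` are read off
from this pairing, with `i` chosen according to the face. -/
theorem sum_bool_insertNth {A : Type*} [AddCommGroup A] {k : ℕ} (i : Fin (k + 1))
    (F : (Fin (k + 1) → Bool) → A) :
    ∑ ι : Fin (k + 1) → Bool,
        (-1 : ℤ) ^ (Finset.univ.filter fun j => ι j = true).card • F ι =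
      ∑ κ : Fin k → Bool, (-1 : ℤ) ^ (Finset.univ.filter fun j => κ j = true).card •
        (F (i.insertNth false κ) - F (i.insertNth true κ)) := by
  rw [← (Fin.insertNthEquiv (fun _ => Bool) i).sum_comp, Fintype.sum_prod_type,
    Fintype.sum_bool, ← Finset.sum_add_distrib]
  refine Finset.sum_congr rfl fun κ _ => ?_
  change _ • F (i.insertNth true κ) + _ • F (i.insertNth false κ) = _
  simp only [sign_eq_prod, Fin.prod_univ_succAbove _ i, Fin.insertNthEquiv_apply,
    Fin.insertNth_apply_same, Fin.insertNth_apply_succAbove, if_true, Bool.false_eq_true, if_false,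
    neg_mul, one_mul, neg_smul, smul_sub]
  rw [neg_add_eq_sub]

section ChainMap

variable {X : Type*} [Shelf X]

theorem inoueKabayaLift_of (p : X) (k : ℕ) (x : Fin (k + 1) → X) :
    inoueKabayaLift p k (FreeAbelianGroup.of x) = ∑ ι : Fin k → Bool,
      (-1 : ℤ) ^ (Finset.univ.filter fun j => ι j = true).card •
        FreeAbelianGroup.of (Fin.cons p (iteratedTri x ι) : Fin (k + 2) → X) :=
  FreeAbelianGroup.lift_apply_of _ _

/-- The exponent of the deleted entry decides which of the two rack faces remains, and its sign
turns the pair into their difference. -/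
theorem sum_sign_delete (p : X) {k : ℕ} (x : Fin (k + 2) → X) (i : Fin (k + 2)) :
    ∑ ι : Fin (k + 1) → Bool,
        (-1 : ℤ) ^ (Finset.univ.filter fun j => ι j = true).card •
          FreeAbelianGroup.of
            (Fin.cons p (fun j => iteratedTri x ι (i.succAbove j)) : Fin (k + 2) → X) =
      inoueKabayaLift p k
        (FreeAbelianGroup.of (rackFace₀ i x) - FreeAbelianGroup.of (rackFace₁ i x)) := by
  refine Fin.cases ?_ (fun i => ?_) i
  -- Nothing precedes position `0`, so the right side vanishes. On the left `ι 0` affects only the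
  -- deleted entry, and flipping it cancels terms.
  · rw [show rackFace₁ 0 x = rackFace₀ 0 x by funext j; simp [rackFace₀, rackFace₁], sub_self,
      map_zero, sum_bool_insertNth 0]
    simp [iteratedTri_succ]
  · rw [sum_bool_insertNth i, map_sub, inoueKabayaLift_of, inoueKabayaLift_of,
      ← Finset.sum_sub_distrib]
    simp [iteratedTri_succ_succAbove, smul_sub]

/-- The boundary of the Inoue–Kabaya chain, up to the faces opposite to the base point. -/
theorem tupleBoundary_inoueKabayaLift (p : X) {k : ℕ} (x : Fin (k + 2) → X) :
    tupleBoundary X (k + 1) (inoueKabayaLift p (k + 1) (FreeAbelianGroup.of x)) =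
      ∑ ι : Fin (k + 1) → Bool,
        (-1 : ℤ) ^ (Finset.univ.filter fun j => ι j = true).card •
          FreeAbelianGroup.of (iteratedTri x ι) +
      inoueKabayaLift p k (rackBoundary X (k + 1) (FreeAbelianGroup.of x)) := by
  have hface : ∀ (ι : Fin (k + 1) → Bool) (i : Fin (k + 2)),
      (fun j => (Fin.cons p (iteratedTri x ι) : Fin (k + 3) → X) (i.succ.succAbove j)) =
        Fin.cons p (fun j => iteratedTri x ι (i.succAbove j)) := by
    intro ι i
    funext j
    refine Fin.cases ?_ (fun j => ?_) j <;> simp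
  have hb : rackBoundary X (k + 1) (FreeAbelianGroup.of x) =
      ∑ i : Fin (k + 2), (-1 : ℤ) ^ ((i : ℕ) + 1) •
        (FreeAbelianGroup.of (rackFace₀ i x) - FreeAbelianGroup.of (rackFace₁ i x)) :=
    FreeAbelianGroup.lift_apply_of _ _
  have hd : ∀ y : Fin (k + 3) → X, tupleBoundary X (k + 1) (FreeAbelianGroup.of y) =
      ∑ i : Fin (k + 3), (-1 : ℤ) ^ (i : ℕ) •
        FreeAbelianGroup.of fun j => y (i.succAbove j) :=
    fun y => FreeAbelianGroup.lift_apply_of _ _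
  rw [inoueKabayaLift_of, hb, map_sum, map_sum]
  -- Face `0` omits `p` and has sign `+1`; face `i.succ` has sign `(-1)^(i+1)`, the sign in the rack
  -- boundary.
  simp only [map_zsmul, hd, Fin.sum_univ_succ (n := k + 2), smul_add, Finset.sum_add_distrib,
    hface, ← sum_sign_delete]
  congr 1
  simp only [Finset.smul_sum]
  rw [Finset.sum_comm]
  exact Finset.sum_congr rfl fun i _ => Finset.sum_congr rfl fun ι _ => smul_comm _ _ _

end ChainMap

theorem tupleBoundary_tupleBoundary (X : Type*) (n : ℕ) (c : TupleChain X (n + 2)) :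
    tupleBoundary X n (tupleBoundary X (n + 1) c) = 0 := by
  suffices h : (tupleBoundary X n).comp (tupleBoundary X (n + 1)) = 0 from DFunLike.congr_fun h c
  ext x
  simp only [tupleBoundary, AddMonoidHom.comp_apply, FreeAbelianGroup.lift_apply_of, map_sum,
    map_zsmul, Finset.smul_sum, smul_smul, ← pow_add, AddMonoidHom.zero_apply]
  rw [← Fintype.sum_prod_type' (f := fun (i : Fin (n + 3)) (j : Fin (n + 2)) =>
    (-1 : ℤ) ^ ((i : ℕ) + j) • FreeAbelianGroup.of fun l => x (i.succAbove (j.succAbove l)))]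
  -- The involution exchanges the order in which two entries are deleted; this preserves the
  -- resulting tuple and reverses the sign.
  refine Finset.sum_involution (fun a _ => (a.1.succAbove a.2, a.2.predAbove a.1)) ?_ ?_
    (fun _ _ => Finset.mem_univ _) ?_
  · rintro ⟨i, j⟩ -
    simp only [Fin.neg_one_pow_succAbove_add_predAbove, neg_smul,
      Fin.succAbove_succAbove_succAbove_predAbove, add_neg_cancel]
  · rintro ⟨i, j⟩ - - h
    exact Fin.succAbove_ne i j (congrArg Prod.fst h)
  · rintro ⟨i, j⟩ -
    simp only [Fin.succAbove_succAbove_predAbove, Fin.predAbove_predAbove_succAbove]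

section Coinvariants

variable {G : Type*} [Group G] {H : Subgroup G} {z₀ : Subgroup.centralizer (H : Set G)}

theorem sum_iteratedTri_mem_coinvariantsKer
    (hInn : ∀ y : CosetQuandle H z₀, ∃ g : G, ∀ x, y ◃ x = CosetQuandle.translate g x)
    {k : ℕ} (x : Fin (k + 2) → CosetQuandle H z₀) :
    ∑ ι : Fin (k + 1) → Bool,
        (-1 : ℤ) ^ (Finset.univ.filter fun j => ι j = true).card •
          FreeAbelianGroup.of (iteratedTri x ι) ∈ coinvariantsKer H z₀ (k + 1) := by
  obtain ⟨g, hg⟩ := hInn (x (Fin.last (k + 1)))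
  rw [sum_bool_insertNth (Fin.last k)]
  refine sum_mem fun κ _ => zsmul_mem ?_ _
  rw [← neg_sub]
  refine neg_mem (AddSubgroup.subset_closure
    ⟨g, FreeAbelianGroup.of (iteratedTri x ((Fin.last k).insertNth false κ)), ?_⟩)
  rw [tupleMap, FreeAbelianGroup.map_of_apply]
  congr 2
  funext j
  rw [← hg]
  refine Fin.lastCases ?_ (fun j => ?_) j
  -- The last entry does not depend on `ι`; idempotence lets the translation fix it.
  · rw [iteratedTri_last, iteratedTri_last, Quandle.fix]
  · simp [iteratedTri_castSucc]

/-- The Inoue–Kabaya map commutes with the boundaries. -/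
theorem inoueKabaya_rackBoundary
    (hInn : ∀ y : CosetQuandle H z₀, ∃ g : G, ∀ x, y ◃ x = CosetQuandle.translate g x)
    (p : CosetQuandle H z₀) (k : ℕ) (c : RackChain (CosetQuandle H z₀) (k + 2)) :
    inoueKabaya p k (rackBoundary _ (k + 1) c) =
      QuotientAddGroup.mk (tupleBoundary _ (k + 1) (inoueKabayaLift p (k + 1) c)) := by
  let P := QuotientAddGroup.mk' (coinvariantsKer H z₀ (k + 1))
  suffices h : (inoueKabaya p k).comp (rackBoundary _ (k + 1)) =
      (P.comp (tupleBoundary _ (k + 1))).comp (inoueKabayaLift p (k + 1)) from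
    DFunLike.congr_fun h c
  ext x
  change P (inoueKabayaLift p k _) = P (tupleBoundary _ (k + 1) _)
  rw [tupleBoundary_inoueKabayaLift, map_add,
    show P (∑ ι : Fin (k + 1) → Bool, _) = 0 from (QuotientAddGroup.eq_zero_iff _).2 (sum_iteratedTri_mem_coinvariantsKer hInn x),
    zero_add]

end Coinvariants

/-! ### Integrals of invariant forms -/

section Integral

variable {E : Type*} [NormedAddCommGroup E] [NormedSpace ℝ E]
  {M : Type*} [TopologicalSpace M] [ChartedSpace E M]

theorem convex_cornerSimplex (n : ℕ) : Convex ℝ (cornerSimplex n) := by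
  intro s hs t ht a b ha hb hab
  refine ⟨fun j => ?_, ?_⟩
  · exact add_nonneg (mul_nonneg ha (hs.1 j)) (mul_nonneg hb (ht.1 j))
  · have : ∑ j, (a • s + b • t) j = a * ∑ j, s j + b * ∑ j, t j := by
      simp [Finset.sum_add_distrib, Finset.mul_sum]
    rw [this]
    nlinarith [hs.2, ht.2, mul_le_mul_of_nonneg_left hs.2 ha, mul_le_mul_of_nonneg_left ht.2 hb]

theorem isClosed_cornerSimplex (n : ℕ) : IsClosed (cornerSimplex n) := by
  have : cornerSimplex n = (⋂ j, {t | 0 ≤ t j}) ∩ {t | ∑ j, t j ≤ 1} := by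
    ext t; simp [cornerSimplex]
  rw [this]
  exact (isClosed_iInter fun j => isClosed_le continuous_const (continuous_apply j)).inter
    (isClosed_le (by fun_prop) continuous_const)

theorem interior_cornerSimplex_nonempty (n : ℕ) : (interior (cornerSimplex n)).Nonempty := by
  have ho : IsOpen ((⋂ j : Fin n, {t : Fin n → ℝ | 0 < t j}) ∩ {t | ∑ j, t j < 1}) :=
    (isOpen_iInter_of_finite fun j => isOpen_lt continuous_const (continuous_apply j)).inter
      (isOpen_lt (by fun_prop) continuous_const)
  -- The barycentre: its coordinates sum to `n / (n + 1) < 1`, also for `n = 0`.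
  refine ⟨fun _ => 1 / (n + 1 : ℝ), interior_maximal ?_ ho ⟨?_, ?_⟩⟩
  · rintro t ⟨h1, h2⟩
    simp only [Set.mem_iInter, Set.mem_ofPred_eq] at h1 h2
    exact ⟨fun j => (h1 j).le, h2.le⟩
  · simp only [Set.mem_iInter, Set.mem_ofPred_eq]
    intro _
    positivity
  · simp only [Set.mem_ofPred_eq, Finset.sum_const, Finset.card_univ, Fintype.card_fin,
      nsmul_eq_mul, mul_one_div]
    rw [div_lt_one (by positivity)]
    linarith

/-- Makes the chain rule for derivatives within the simplex valid up to its boundary. -/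
theorem uniqueMDiffOn_cornerSimplex (n : ℕ) :
    UniqueMDiffOn 𝓘(ℝ, Fin n → ℝ) (cornerSimplex n) :=
  (uniqueDiffOn_convex (convex_cornerSimplex n) (interior_cornerSimplex_nonempty n)).uniqueMDiffOn

theorem SmoothSimplex.contMDiffOn_inCoords {n : ℕ} (σ : SmoothSimplex E M n) :
    ContMDiffOn 𝓘(ℝ, Fin n → ℝ) 𝓘(ℝ, E) ∞ σ.inCoords (cornerSimplex n) := by
  obtain ⟨U, f, -, hsub, hf, hσ⟩ := σ.exists_extension
  have hL : ContDiff ℝ ∞ (fun t : Fin n → ℝ => (Fin.cons (1 - ∑ j, t j) t : Fin (n + 1) → ℝ)) := by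
    rw [contDiff_pi]
    intro i
    refine Fin.cases ?_ (fun j => ?_) i
    · simp only [Fin.cons_zero]; fun_prop
    · simp only [Fin.cons_succ]; fun_prop
  refine (hf.comp hL.contMDiff.contMDiffOn fun t ht => hsub (cons_mem_stdSimplex ht)).congr ?_
  intro t ht
  rw [SmoothSimplex.inCoords, dif_pos ht]
  exact hσ _

theorem SmoothSimplex.inCoords_map {f : M → M} (hf : ContMDiff 𝓘(ℝ, E) 𝓘(ℝ, E) ∞ f) {n : ℕ}
    (σ : SmoothSimplex E M n) : (σ.map hf).inCoords = f ∘ σ.inCoords := by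
  funext t
  -- Off the simplex both sides take their value at the same vertex, so the equality holds for all
  -- `t`.
  by_cases ht : t ∈ cornerSimplex n <;>
    simp only [SmoothSimplex.inCoords, Function.comp_apply, ht, dite_true, dite_false] <;> rfl

/-- By the chain rule the integrand for `f ∘ σ` is that of `f^* α = α` along `σ`, pointwise on the
simplex; no change of variables enters. -/
theorem SmoothForm.integralSimplex_map {q : ℕ} (α : SmoothForm E M q) {f : M → M}
    (hf : ContMDiff 𝓘(ℝ, E) 𝓘(ℝ, E) ∞ f) (hα : α.InvariantUnder f) (σ : SmoothSimplex E M q) :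
    α.integralSimplex (σ.map hf) = α.integralSimplex σ := by
  unfold SmoothForm.integralSimplex
  rw [SmoothSimplex.inCoords_map]
  refine MeasureTheory.setIntegral_congr_fun (isClosed_cornerSimplex q).measurableSet ?_
  intro t ht
  have hσ := (σ.contMDiffOn_inCoords t ht).mdifferentiableWithinAt (by simp)
  have hc : mfderivWithin 𝓘(ℝ, Fin q → ℝ) 𝓘(ℝ, E) (f ∘ σ.inCoords) (cornerSimplex q) t =
      (mfderiv 𝓘(ℝ, E) 𝓘(ℝ, E) f (σ.inCoords t)).comp
        (mfderivWithin 𝓘(ℝ, Fin q → ℝ) 𝓘(ℝ, E) σ.inCoords (cornerSimplex q) t) :=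
    mfderiv_comp_mfderivWithin t ((hf _).mdifferentiableAt (by simp)) hσ
      (uniqueMDiffOn_cornerSimplex q t ht)
  beta_reduce
  rw [hc, ← hα (σ.inCoords t)]
  rfl

theorem SmoothForm.integral_smoothChainMap {q : ℕ} (α : SmoothForm E M q) {f : M → M}
    (hf : ContMDiff 𝓘(ℝ, E) 𝓘(ℝ, E) ∞ f) (hα : α.InvariantUnder f) (c : SmoothChain E M q) :
    α.integral (smoothChainMap hf q c) = α.integral c := by
  suffices h : α.integral.comp (smoothChainMap hf q) = α.integral from DFunLike.congr_fun h c
  ext σ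
  simp only [AddMonoidHom.comp_apply, smoothChainMap, FreeAbelianGroup.map_of_apply,
    SmoothForm.integral, FreeAbelianGroup.lift_apply_of]
  exact α.integralSimplex_map hf hα σ

end Integral

/-! ### The secondary cochain -/

section SecondaryCochain

variable {EG EQ : Type*} [NormedAddCommGroup EG] [NormedSpace ℝ EG]
  [NormedAddCommGroup EQ] [NormedSpace ℝ EQ]
  {G : Type*} [Group G] [TopologicalSpace G] [ChartedSpace EG G] [LieGroup 𝓘(ℝ, EG) ∞ G]
  {H : Subgroup G} {z₀ : Subgroup.centralizer (H : Set G)}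
  [ChartedSpace EQ (CosetQuandle H z₀)] [IsManifold 𝓘(ℝ, EQ) ∞ (CosetQuandle H z₀)]
  {hmk : Manifold.IsSubmersion 𝓘(ℝ, EG) 𝓘(ℝ, EQ) ∞ (CosetQuandle.mk H z₀)}

/-- Equivariance carries `g` through `τ` to smooth chains, where invariance of `α` makes the
integrals equal already in `ℂ`. -/
theorem coinvariantsKer_le_ker_secondaryCochain {q : ℕ}
    (α : SmoothForm EQ (CosetQuandle H z₀) q)
    (hinv : ∀ g : G, α.InvariantUnder (CosetQuandle.translate g))
    (τ : EquivariantChainMap hmk q) :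
    coinvariantsKer H z₀ q ≤ (secondaryCochain α τ).ker := by
  refine (AddSubgroup.closure_le _).2 ?_
  rintro _ ⟨g, c, rfl⟩
  rw [SetLike.mem_coe, AddMonoidHom.mem_ker, map_sub, sub_eq_zero]
  simp only [secondaryCochain, AddMonoidHom.comp_apply]
  rw [τ.equivariant q le_rfl, α.integral_smoothChainMap _ (hinv g)]

/-- The secondary cochain of a form with integral periods is a cocycle. -/
theorem secondaryCochain_tupleBoundary {k : ℕ} (α : SmoothForm EQ (CosetQuandle H z₀) (k + 1))
    (hint : ∀ z, smoothBoundary EQ (CosetQuandle H z₀) k z = 0 → ∃ m : ℤ, α.integral z = m)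
    (τ : EquivariantChainMap hmk (k + 1)) (c : TupleChain (CosetQuandle H z₀) (k + 2)) :
    secondaryCochain α τ (tupleBoundary _ (k + 1) c) = 0 := by
  -- The image under `τ` of a tuple boundary is a smooth cycle, so `α` has an integral period on it.
  obtain ⟨m, hm⟩ := hint (τ.toFun (k + 1) (tupleBoundary _ (k + 1) c)) (by
    rw [τ.boundary k le_rfl, tupleBoundary_tupleBoundary, map_zero])
  refine (QuotientAddGroup.eq_zero_iff _).2 (AddSubgroup.mem_zmultiples_iff.2 ⟨m, ?_⟩)
  rw [zsmul_eq_mul, mul_one]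
  exact hm.symm

end SecondaryCochain

end SmoothQuandle

theorem mainTheorem7
    {EG EQ : Type*} [NormedAddCommGroup EG] [NormedSpace ℝ EG] [FiniteDimensional ℝ EG]
    [NormedAddCommGroup EQ] [NormedSpace ℝ EQ] [FiniteDimensional ℝ EQ]
    -- the Lie group `G`, the closed subgroup `H`, the element `z₀` commuting with `H`
    {G : Type*} [Group G] [TopologicalSpace G] [ChartedSpace EG G] [LieGroup 𝓘(ℝ, EG) ∞ G]
    (H : Subgroup G) (hH : IsClosed (H : Set G)) (z₀ : Subgroup.centralizer (H : Set G))
    -- the manifold structure of `Q = H \ G`, for which the projection is a smooth submersion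
    [ChartedSpace EQ (SmoothQuandle.CosetQuandle H z₀)]
    [IsManifold 𝓘(ℝ, EQ) ∞ (SmoothQuandle.CosetQuandle H z₀)]
    (hmk : Manifold.IsSubmersion 𝓘(ℝ, EG) 𝓘(ℝ, EQ) ∞ (SmoothQuandle.CosetQuandle.mk H z₀))
    -- every inner automorphism `x ↦ x ◁ y` is the action of an element of `G`
    (hInn : ∀ y : SmoothQuandle.CosetQuandle H z₀, ∃ g : G,
      ∀ x : SmoothQuandle.CosetQuandle H z₀,
        y ◃ x = SmoothQuandle.CosetQuandle.translate g x)
    -- `q = k + 1`, and `Q` is `(q - 1)`-connected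
    (k : ℕ) (hconn : SmoothQuandle.IsNConnected k (SmoothQuandle.CosetQuandle H z₀))
    -- a closed `G`-invariant `q`-form with integral periods
    (α : SmoothQuandle.SmoothForm EQ (SmoothQuandle.CosetQuandle H z₀) (k + 1))
    (hclosed : α.Closed)
    (hinv : ∀ g : G, α.InvariantUnder (SmoothQuandle.CosetQuandle.translate g))
    (hint : ∀ z : SmoothQuandle.SmoothChain EQ (SmoothQuandle.CosetQuandle H z₀) (k + 1),
      SmoothQuandle.smoothBoundary EQ (SmoothQuandle.CosetQuandle H z₀) k z = 0 →
        ∃ m : ℤ, α.integral z = m)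
    -- the chain map `τ` in degrees `≤ q`, and the base point `p`
    (τ : SmoothQuandle.EquivariantChainMap hmk (k + 1))
    (p : SmoothQuandle.CosetQuandle H z₀) :
    ∃ T : SmoothQuandle.Coinvariants H z₀ (k + 1) →+ ℂ ⧸ AddSubgroup.zmultiples (1 : ℂ),
      (∀ c, T (QuotientAddGroup.mk c) = SmoothQuandle.secondaryCochain α τ c) ∧
        SmoothQuandle.IsRackCocycle (T.comp (SmoothQuandle.inoueKabaya p k)) := by
  refine ⟨QuotientAddGroup.lift _ (SmoothQuandle.secondaryCochain α τ)
    (SmoothQuandle.coinvariantsKer_le_ker_secondaryCochain α hinv τ), fun c => rfl, ?_⟩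
  refine AddMonoidHom.ext fun c => ?_
  rw [AddMonoidHom.comp_apply, AddMonoidHom.comp_apply,
    SmoothQuandle.inoueKabaya_rackBoundary hInn]
  exact SmoothQuandle.secondaryCochain_tupleBoundary α hint τ _
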